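/- Let $F\colon\mathbb{R}^d\to\mathbb{R}^d$ be $L$-Lipschitz with $L>0$, let $G\colon\mathbb{R}^d\rightrightarrows\mathbb{R}^d$ be maximally monotone, and let $F+G$ be maximally $\rho$-cohypomonotone with $\rho\ge 0$; that is, $\langle u-v,x-y\rangle\ge-\rho\|u-v\|^2$ for all $(x,u),(y,v)$ in the graph of $F+G$, and this graph is not strictly contained in the graph of another operator with this property. Let $\rho<\eta<\frac1L$, let $x^\star$ satisfy $0\in F(x^\star)+G(x^\star)$, and let $x_0\in\mathbb{R}^d$. For a set-valued operator $A$, let $J_A=(\mathrm{Id}+A)^{-1}$ denote its resolvent. Put $\alpha=1-\frac{\rho}{\eta}$, $\beta_k=\frac1{k+2}$, $\tau=\frac{1}{2(1+\eta L)}$ and $$N_k=\left\lceil\frac{4(1+\eta L)}{1-\eta L}\log\bigl(98\sqrt{k+2}\,\log(k+2)\bigr)\right\rceil .$$ The inexact Halpern iteration computes, for $k=0,1,2,\dots$, $$x_{k+1}=\beta_kx_0+(1-\beta_k)\bigl((1-\alpha)x_k+\alpha\widetilde J_k\bigr),$$ where $\widetilde J_k=z_{N_k}$ is the result of $N_k$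 forward-backward-forward steps started at $z_0=x_k$: with $B(z)=z+\eta F(z)-x_k$, $$z_{t+1/2}=J_{\tau\eta G}\bigl(z_t-\tau B(z_t)\bigr),\qquad z_{t+1}=z_{t+1/2}+\tau B(z_t)-\tau B(z_{t+1/2}),\qquad t=0,\dots,N_k-1 .$$ Then the resolvents $J_{cG}$ ($c>0$) and $J_{\eta(F+G)}$ are single-valued and defined on all of $\mathbb{R}^d$, and for every $k\ge1$, $$\frac1{\eta^2}\,\|x_k-J_{\eta(F+G)}(x_k)\|^2\le\frac{16\,\|x_0-x^\star\|^2}{(\eta-\rho)^2(k+1)^2}.$$ Moreover, for every $k\ge0$, iteration $k$ (the computation of $x_{k+1}$ from $x_k$) uses at most $2N_k$ first-order oracle calls, where one call consists of one evaluation of $F$ and one evaluation of a resolvent $J_{cG}$ (so that a run with $m$ evaluations of $F$ and $n$ of resolvents uses $\max(m,n)$ calls). -/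

import Mathlib

open scoped NNReal

noncomputable section

/-- The space `ℝ^d` with the `ℓ₂` norm. -/
abbrev Vec (d : ℕ) : Type := EuclideanSpace ℝ (Fin d)

/-! ### Set-valued operators on a real inner product space -/

namespace SetOp

variable {E : Type*} [NormedAddCommGroup E] [InnerProductSpace ℝ E]

/-- The graph of a set-valued operator. -/
def graph (A : E → Set E) : Set (E × E) := {p | p.2 ∈ A p.1}

/-- `⟨u - v, x - y⟩ ≥ 0` for all `(x, u)`, `(y, v)` in the graph. -/
def IsMonotone (A : E → Set E) : Prop :=
  ∀ x u y v, (x, u) ∈ graph A → (y, v) ∈ graph A → 0 ≤ inner ℝ (u - v) (x - y)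

/-- `⟨u - v, x - y⟩ ≥ -ρ ‖u - v‖²` for all `(x, u)`, `(y, v)` in the graph. -/
def IsCohypomonotone (ρ : ℝ) (A : E → Set E) : Prop :=
  ∀ x u y v, (x, u) ∈ graph A → (y, v) ∈ graph A →
    -ρ * ‖u - v‖ ^ 2 ≤ inner ℝ (u - v) (x - y)

/-- A monotone operator whose graph is not strictly contained in the graph of a monotone
operator. -/
def IsMaximallyMonotone (A : E → Set E) : Prop :=
  IsMonotone A ∧ ∀ B : E → Set E, IsMonotone B → ¬ graph A ⊂ graph B

/-- A `ρ`-cohypomonotone operator whose graph is not strictly contained in the graph of a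
`ρ`-cohypomonotone operator. -/
def IsMaximallyCohypomonotone (ρ : ℝ) (A : E → Set E) : Prop :=
  IsCohypomonotone ρ A ∧ ∀ B : E → Set E, IsCohypomonotone ρ B → ¬ graph A ⊂ graph B

/-- The sum `F + G` of a single-valued and a set-valued operator. -/
def add (F : E → E) (G : E → Set E) : E → Set E := fun x => {w | ∃ u ∈ G x, w = F x + u}

/-- The operator `c A`. -/
def scale (c : ℝ) (A : E → Set E) : E → Set E := fun x => {w | ∃ u ∈ A x, w = c • u}

/-- The resolvent `J_A = (Id + A)⁻¹`, as a set-valued operator: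
`y ∈ J_A x` iff `x ∈ y + A y`. -/
def resolvent (A : E → Set E) : E → Set E := fun x => {y | ∃ u ∈ A y, x = y + u}

/-- The value of the resolvent at a point where it is single-valued
(an arbitrary element of `J_A x` if there are several, a junk value if there is none). -/
def resolventMap (A : E → Set E) (x : E) : E := Classical.epsilon fun y => y ∈ resolvent A x

end SetOp

/-! ### Programs with oracle access to an operator `F` and to the resolvents of `G` -/

/-- A program that computes a value of type `α` and reaches the operators `F` and `G` only through
two kinds of queries: `evalF x` (answered by `F x`) and `resolventG c y` (answered by
`J_{c G} y`). -/
inductive OracleProg (E : Type*) (α : Type*) where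
  | ret : α → OracleProg E α
  | evalF : E → (E → OracleProg E α) → OracleProg E α
  | resolventG : ℝ → E → (E → OracleProg E α) → OracleProg E α

namespace OracleProg

variable {E : Type*} {α β : Type*}

/-- Sequential composition of programs. -/
def andThen : OracleProg E α → (α → OracleProg E β) → OracleProg E β
  | ret a, f => f a
  | evalF x k, f => evalF x fun v => andThen (k v) f
  | resolventG c y k, f => resolventG c y fun v => andThen (k v) f

instance : Monad (OracleProg E) where
  pure := ret
  bind := andThen

/-- The program that makes one evaluation of `F`. -/
def queryF (x : E) : OracleProg E E := evalF x ret

/-- The program that makes one evaluation of the resolvent `J_{c G}`. -/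
def queryResolvent (c : ℝ) (y : E) : OracleProg E E := resolventG c y ret

variable [NormedAddCommGroup E] [InnerProductSpace ℝ E] (F : E → E) (G : E → Set E)

/-- The value computed by a program. -/
def value : OracleProg E α → α
  | ret a => a
  | evalF x k => value (k (F x))
  | resolventG c y k => value (k (SetOp.resolventMap (SetOp.scale c G) y))

/-- The number of evaluations of `F` made by a run of the program. -/
def countF : OracleProg E α → ℕ
  | ret _ => 0
  | evalF x k => countF (k (F x)) + 1
  | resolventG c y k => countF (k (SetOp.resolventMap (SetOp.scale c G) y))

/-- The number of resolvent evaluations made by a run of the program. -/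
def countResolvent : OracleProg E α → ℕ
  | ret _ => 0
  | evalF x k => countResolvent (k (F x))
  | resolventG c y k => countResolvent (k (SetOp.resolventMap (SetOp.scale c G) y)) + 1

/-- The number of first-order oracle calls used by a run of the program. One call pays for one
evaluation of `F` and one resolvent of `G`, so that `m` calls pay for at most `m` evaluations of
`F` and at most `m` resolvents of `G`. -/
def oracleCalls (p : OracleProg E α) : ℕ := max (countF F G p) (countResolvent F G p)

end OracleProg

/-! ### The algorithms -/

namespace Halpern

open OracleProg

variable {E : Type*} [NormedAddCommGroup E] [InnerProductSpace ℝ E]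

/-- One forward-backward-forward step from `z`, with step size `τ`, for the operators `A` and
`B = B_in - z₀`; `JA τ` is a program for the resolvent of `τ A`, and `Bin` one for `B_in`. -/
def fbfStep (z₀ : E) (JA : ℝ → E → OracleProg E E) (Bin : E → OracleProg E E) (τ : ℝ) (z : E) :
    OracleProg E E := do
  let b ← Bin z
  let zHalf ← JA τ (z - τ • (b - z₀))
  let bHalf ← Bin zHalf
  return zHalf + τ • (b - z₀) - τ • (bHalf - z₀)

/-- `FBF(z₀, N, A, B_in, L_B)`: `N` forward-backward-forward steps with `τ = 1 / (2 L_B)`,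
started at `z₀`. -/
def fbf (z₀ : E) (N : ℕ) (JA : ℝ → E → OracleProg E E) (Bin : E → OracleProg E E) (LB : ℝ) :
    OracleProg E E :=
  match N with
  | 0 => return z₀
  | t + 1 => do
    let z ← fbf z₀ t JA Bin LB
    fbfStep z₀ JA Bin (1 / (2 * LB)) z

/-- `N_k = ⌈4 (1 + ηL) / (1 - ηL) · log (98 √(k+2) log (k+2))⌉`. -/
def innerIterations (η L : ℝ) (k : ℕ) : ℕ :=
  ⌈4 * (1 + η * L) / (1 - η * L) *
    Real.log (98 * Real.sqrt ((k : ℝ) + 2) * Real.log ((k : ℝ) + 2))⌉₊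

/-- The approximation `FBF(x, N, ηG, Id + ηF, 1 + ηL)` of `J_{η(F+G)} x`. The resolvent of
`τ (η G)` is the resolvent of `(τ η) G`. -/
def approxResolvent (η L : ℝ) (N : ℕ) (x : E) : OracleProg E E :=
  fbf x N (fun τ y => queryResolvent (τ * η) y)
    (fun z => do
      let v ← queryF z
      return z + η • v)
    (1 + η * L)

/-- Iteration `k` of the inexact Halpern iteration, from the current iterate `x`, with
`β_k = 1 / (k + 2)` and `α = 1 - ρ / η`. -/
def step (η L ρ : ℝ) (x₀ : E) (k : ℕ) (x : E) : OracleProg E E := do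
  let J ← approxResolvent η L (innerIterations η L k) x
  let β : ℝ := 1 / ((k : ℝ) + 2)
  let α : ℝ := 1 - ρ / η
  return β • x₀ + (1 - β) • ((1 - α) • x + α • J)

/-- The iterates `x_k` of the inexact Halpern iteration. -/
def iterate (F : E → E) (G : E → Set E) (η L ρ : ℝ) (x₀ : E) : ℕ → E
  | 0 => x₀
  | k + 1 => value F G (step η L ρ x₀ k (iterate F G η L ρ x₀ k))

/-- The number of first-order oracle calls used in iteration `k`, which computes `x_{k+1}` from
`x_k`. -/
def callsAt (F : E → E) (G : E → Set E) (η L ρ : ℝ) (x₀ : E) (k : ℕ) : ℕ :=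
  oracleCalls F G (step η L ρ x₀ k (iterate F G η L ρ x₀ k))

end Halpern

end

/-! Write `u` for the element of `(F + G) (J x)` with `x = J x + η u`, where `J` is the resolvent of
`η (F + G)`. Cohypomonotonicity makes the scaled residual `r = (η - ρ) u` 1-cocoercive in `x`, and
`(1 - α) x + α J x = x - r`; the outer loop is thus Halpern's iteration for a firmly nonexpansive
map, with an error in each step.

Exact Halpern does not increase the potential `k (k + 1) / 2 ‖r‖² + (k + 1) ⟪r, x_k - x₀⟫`, and a
bound on it gives `‖r‖ = O(1 / k)`. An error of relative size `ε_k` adds at most `((k + 1) ‖r‖)²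
(ε_k² + ε_k / (k + 1))` (`mul_norm_residual_le`). The rate at step `k` bounds the first factor, so
the induction closes once these weights sum to at most `1 / 4` (`sum_errorScale_le`).

The inner problem is strongly monotone and Lipschitz because `η L < 1`, so forward-backward-forward
converges linearly. Its start at `x_k` makes the error relative to `‖x_k - J x_k‖`, and `N_k` yields
`ε_k = 1 / (98 √(k+2) log (k+2))`.

Existence of the resolvents is Minty's theorem, proved by finite-dimensional duality and
compactness. -/

namespace SetOp

/-! ### Minty's theorem -/

variable {E : Type*} [NormedAddCommGroup E] [InnerProductSpace ℝ E]

/-- Finite families of mutually antimonotone pairs have a common antimonotone centre. -/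
theorem exists_forall_inner_sub_nonpos {ι : Type*} [Fintype ι] [Nonempty ι] (a c : ι → E)
    (h : ∀ i j, inner ℝ (c i - c j) (a i - a j) ≤ 0) :
    ∃ z, ∀ i, inner ℝ (z - a i) (z - c i) ≤ 0 := by
  classical
  let m : ι → E := fun i => (1 / 2 : ℝ) • (a i + c i)
  let p : ι → ℝ := fun i => inner ℝ (a i) (c i)
  -- Since `⟪z - a i, z - c i⟫ = ‖z‖² - 2 ⟪z, m i⟫ + p i`, this is the Lagrangian dual of minimising
  -- over `z` the maximum of these quantities over `i`; the centre is read off a dual maximiser.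
  let D : (ι → ℝ) → ℝ := fun w => ∑ i, w i * p i - ‖∑ i, w i • m i‖ ^ 2
  have hD : Continuous D := by fun_prop
  obtain ⟨w, hw, hmax⟩ := (isCompact_stdSimplex ℝ ι).exists_isMaxOn
    ⟨_, single_mem_stdSimplex ℝ (Classical.arbitrary ι)⟩ hD.continuousOn
  set z := ∑ i, w i • m i with hz
  set P := ∑ i, w i * p i with hP
  -- The dual value is nonpositive: averaging the hypothesis over pairs gives `P ≤ ⟪A, C⟫`, and `⟪A,
  -- C⟫ ≤ ‖(A + C) / 2‖² = ‖z‖²`.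
  have hnonpos : P - ‖z‖ ^ 2 ≤ 0 := by
    set A := ∑ i, w i • a i with hA
    set C := ∑ i, w i • c i with hC
    have hzAC : z = (1 / 2 : ℝ) • (A + C) := by
      simp only [hz, hA, hC, m, smul_add, Finset.smul_sum, Finset.sum_add_distrib]
      congr 1 <;> exact Finset.sum_congr rfl fun i _ => smul_comm _ _ _
    have hAC : ∑ i, ∑ j, w i * w j * inner ℝ (a i) (c j) = inner ℝ A C := by
      rw [Finset.sum_comm]
      simp only [hA, hC, sum_inner, inner_sum, real_inner_smul_left, real_inner_smul_right]
      exact Finset.sum_congr rfl fun i _ => Finset.sum_congr rfl fun j _ => by ring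
    have h1 : ∑ i, ∑ j, w i * w j * inner ℝ (c i - c j) (a i - a j) ≤ 0 :=
      Finset.sum_nonpos fun i _ => Finset.sum_nonpos fun j _ =>
        mul_nonpos_of_nonneg_of_nonpos (mul_nonneg (hw.1 i) (hw.1 j)) (h i j)
    have h2 : ∑ i, ∑ j, w i * w j * inner ℝ (c i - c j) (a i - a j)
        = P - inner ℝ A C - inner ℝ A C + P := by
      have e1 : ∑ i, ∑ j, w i * w j * p i = P := by
        rw [hP]
        refine Finset.sum_congr rfl fun i _ => ?_
        rw [← Finset.sum_mul, ← Finset.mul_sum, hw.2, mul_one]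
      have e2 : ∑ i, ∑ j, w i * w j * p j = P := by
        rw [Finset.sum_comm, ← e1]
        exact Finset.sum_congr rfl fun i _ => Finset.sum_congr rfl fun j _ => by ring
      have e3 : ∑ i, ∑ j, w i * w j * inner ℝ (a j) (c i) = inner ℝ A C := by
        rw [Finset.sum_comm, ← hAC]
        exact Finset.sum_congr rfl fun i _ => Finset.sum_congr rfl fun j _ => by ring
      rw [← e1]
      nth_rw 2 [e1]
      rw [← e2]
      nth_rw 1 [← hAC]
      rw [← e3]
      simp only [← Finset.sum_add_distrib, ← Finset.sum_sub_distrib]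
      refine Finset.sum_congr rfl fun i _ => Finset.sum_congr rfl fun j _ => ?_
      simp only [inner_sub_left, inner_sub_right, p, real_inner_comm (a _) (c _)]
      ring
    have h3 : inner ℝ A C ≤ ‖z‖ ^ 2 := by
      rw [hzAC, norm_smul, mul_pow, norm_add_sq_real]
      have := norm_sub_sq_real A C
      norm_num
      nlinarith [sq_nonneg ‖A - C‖]
    linarith
  refine ⟨z, fun i => ?_⟩
  -- Optimality of `w` against a move of length `t` towards vertex `i`; letting `t → 0` gives the
  -- first-order condition `hlim`.
  have hstep : ∀ t : ℝ, 0 < t → t ≤ 1 →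
      p i - P - 2 * inner ℝ z (m i - z) ≤ t * ‖m i - z‖ ^ 2 := by
    intro t ht ht1
    have hmem : (1 - t) • w + t • (Pi.single i 1 : ι → ℝ) ∈ stdSimplex ℝ ι :=
      convex_stdSimplex ℝ ι hw (single_mem_stdSimplex ℝ i) (by linarith) ht.le (by ring)
    have := hmax hmem
    have e1 : ∑ j, ((1 - t) • w + t • (Pi.single i 1 : ι → ℝ)) j * p j = P + t * (p i - P) := by
      simp only [Pi.add_apply, Pi.smul_apply, smul_eq_mul, add_mul, Finset.sum_add_distrib,
        mul_assoc, ← Finset.mul_sum, Pi.single_apply, ite_mul, one_mul, zero_mul,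
        Finset.sum_ite_eq', Finset.mem_univ, if_true, ← hP]
      ring
    have e2 : ∑ j, ((1 - t) • w + t • (Pi.single i 1 : ι → ℝ)) j • m j = z + t • (m i - z) := by
      simp only [Pi.add_apply, Pi.smul_apply, smul_eq_mul, add_smul, Finset.sum_add_distrib,
        mul_smul, ← Finset.smul_sum, Pi.single_apply, ite_smul, one_smul, zero_smul,
        Finset.sum_ite_eq', Finset.mem_univ, if_true, ← hz]
      module
    simp only [Set.mem_ofPred_eq, D, e1, e2, ← hP, ← hz] at this
    rw [norm_add_sq_real, real_inner_smul_right, norm_smul, mul_pow, Real.norm_eq_abs,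
      sq_abs] at this
    refine le_of_mul_le_mul_left ?_ ht
    nlinarith
  have hlim : p i - P - 2 * inner ℝ z (m i - z) ≤ 0 := by
    by_contra! hpos
    set s := p i - P - 2 * inner ℝ z (m i - z)
    have hb : 0 ≤ ‖m i - z‖ ^ 2 := sq_nonneg _
    have h1 := hstep (min 1 (s / (2 * (‖m i - z‖ ^ 2 + 1)))) (by positivity) (min_le_left _ _)
    have h2 : min 1 (s / (2 * (‖m i - z‖ ^ 2 + 1))) * ‖m i - z‖ ^ 2
        ≤ s / (2 * (‖m i - z‖ ^ 2 + 1)) * (‖m i - z‖ ^ 2 + 1) := by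
      gcongr
      · exact min_le_right _ _
      · linarith
    have h3 : s / (2 * (‖m i - z‖ ^ 2 + 1)) * (‖m i - z‖ ^ 2 + 1) = s / 2 := by
      field_simp
    linarith
  have e : inner ℝ (z - a i) (z - c i) = ‖z‖ ^ 2 - 2 * inner ℝ z (m i) + p i := by
    simp only [inner_sub_left, inner_sub_right, m, p, real_inner_smul_right, inner_add_right,
      real_inner_self_eq_norm_sq, real_inner_comm z (a i)]
    ring
  rw [inner_sub_right, real_inner_self_eq_norm_sq] at hlim
  linarith

theorem isClosed_setOf_inner_sub_nonpos (a c : E) :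
    IsClosed {z : E | inner ℝ (z - a) (z - c) ≤ 0} :=
  isClosed_le (by fun_prop) continuous_const

theorem setOf_inner_sub_nonpos_subset_closedBall (a c : E) :
    {z : E | inner ℝ (z - a) (z - c) ≤ 0} ⊆ Metric.closedBall c ‖c - a‖ := by
  intro z hz
  rw [mem_closedBall_iff_norm]
  have h1 : inner ℝ (z - a) (z - c) = ‖z - c‖ ^ 2 + inner ℝ (c - a) (z - c) := by
    rw [← real_inner_self_eq_norm_sq, ← inner_add_left]; congr 1; abel
  have h2 := abs_le.1 (abs_real_inner_le_norm (c - a) (z - c))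
  have h3 : inner ℝ (z - a) (z - c) ≤ 0 := hz
  by_contra! hlt
  nlinarith [norm_nonneg (z - c), norm_nonneg (c - a)]

/-- Each condition confines `z` to the ball with diameter from `p.1` to `p.2`, which is compact, so
the finite case extends by the finite intersection property. -/
theorem exists_forall_mem_inner_sub_nonpos [ProperSpace E] (S : Set (E × E))
    (h : ∀ p ∈ S, ∀ q ∈ S, inner ℝ (p.2 - q.2) (p.1 - q.1) ≤ 0) :
    ∃ z, ∀ p ∈ S, inner ℝ (z - p.1) (z - p.2) ≤ 0 := by
  rcases S.eq_empty_or_nonempty with rfl | ⟨p₀, hp₀⟩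
  · exact ⟨0, by simp⟩
  let K : S → Set E := fun p => {z | inner ℝ (z - p.1.1) (z - p.1.2) ≤ 0}
  have hK : IsCompact (K ⟨p₀, hp₀⟩) :=
    (isCompact_closedBall _ _).of_isClosed_subset (isClosed_setOf_inner_sub_nonpos _ _)
      (setOf_inner_sub_nonpos_subset_closedBall _ _)
  obtain ⟨z, -, hz⟩ := hK.inter_iInter_nonempty K
    (fun p => isClosed_setOf_inner_sub_nonpos _ _) fun u => by
      classical
      have : Nonempty ↥(insert (⟨p₀, hp₀⟩ : S) u) := ⟨⟨_, Finset.mem_insert_self _ _⟩⟩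
      obtain ⟨z, hz⟩ := exists_forall_inner_sub_nonpos
        (fun i : ↥(insert (⟨p₀, hp₀⟩ : S) u) => i.1.1.1) (fun i => i.1.1.2)
        fun i j => h _ i.1.2 _ j.1.2
      refine ⟨z, hz ⟨_, Finset.mem_insert_self _ _⟩, Set.mem_iInter₂.2 fun i hi => ?_⟩
      exact hz ⟨i, Finset.mem_insert_of_mem hi⟩
  exact ⟨z, fun p hp => Set.mem_iInter.1 hz ⟨p, hp⟩⟩

/-- Otherwise adjoining `(z, w)` would enlarge the graph and keep it cohypomonotone. -/
theorem IsMaximallyCohypomonotone.mem {ρ : ℝ} {A : E → Set E}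
    (hA : IsMaximallyCohypomonotone ρ A) {z w : E}
    (h : ∀ x u, u ∈ A x → -ρ * ‖w - u‖ ^ 2 ≤ inner ℝ (w - u) (z - x)) : w ∈ A z := by
  by_contra hw
  refine hA.2 (fun x => A x ∪ {u | x = z ∧ u = w}) ?_ ?_
  · rintro x u y v (hu | ⟨rfl, rfl⟩) (hv | ⟨rfl, rfl⟩)
    · exact hA.1 x u y v hu hv
    · have := h x u hu
      rwa [norm_sub_rev, ← neg_sub v u, ← neg_sub y x, inner_neg_neg]
    · exact h y v hv
    · simp
  · refine ⟨fun p hp => Or.inl hp, fun hsub => hw ?_⟩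
    exact hsub (show (z, w) ∈ graph _ from Or.inr ⟨rfl, rfl⟩)

theorem IsMaximallyMonotone.isMaximallyCohypomonotone {A : E → Set E}
    (hA : IsMaximallyMonotone A) : IsMaximallyCohypomonotone 0 A := by
  simpa [IsMaximallyMonotone, IsMaximallyCohypomonotone, IsMonotone, IsCohypomonotone] using hA

/-- Minty's theorem for cohypomonotone operators. -/
theorem IsMaximallyCohypomonotone.existsUnique_mem_resolvent [ProperSpace E] {ρ c : ℝ}
    {A : E → Set E} (hA : IsMaximallyCohypomonotone ρ A) (hρ : ρ < c) (y : E) :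
    ∃! z, z ∈ resolvent (scale c A) y := by
  have hκ : 0 < c - ρ := sub_pos.2 hρ
  -- The shift `x + ρ u` turns cohypomonotonicity into monotonicity; `y - (c - ρ) u` reverses the
  -- sign. The centre `z` is then the shifted solution: `y = z + (c - ρ) w` with `w ∈ A (z - ρ w)`.
  obtain ⟨z, hz⟩ := exists_forall_mem_inner_sub_nonpos
    {p : E × E | ∃ x u, u ∈ A x ∧ p = (x + ρ • u, y - (c - ρ) • u)} (by
      rintro _ ⟨x, u, hu, rfl⟩ _ ⟨x', u', hu', rfl⟩
      have := hA.1 x u x' u' hu hu'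
      have e1 : y - (c - ρ) • u - (y - (c - ρ) • u') = -((c - ρ) • (u - u')) := by module
      have e2 : x + ρ • u - (x' + ρ • u') = (x - x') + ρ • (u - u') := by module
      simp only [e1, e2, inner_neg_left, real_inner_smul_left, inner_add_right,
        real_inner_smul_right, real_inner_self_eq_norm_sq]
      nlinarith)
  set w := (c - ρ)⁻¹ • (y - z) with hw
  have hyz : y = z + (c - ρ) • w := by rw [hw, smul_inv_smul₀ hκ.ne']; abel
  have hmem : w ∈ A (z - ρ • w) := hA.mem fun x u hu => by
    have := hz _ ⟨x, u, hu, rfl⟩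
    have e1 : z - (x + ρ • u) = (z - ρ • w - x) + ρ • (w - u) := by module
    have e2 : z - (y - (c - ρ) • u) = -((c - ρ) • (w - u)) := by rw [hyz]; module
    simp only [e1, e2, inner_neg_right, real_inner_smul_left, inner_add_left,
        real_inner_smul_right, real_inner_self_eq_norm_sq] at this
    rw [real_inner_comm]
    nlinarith
  refine ⟨z - ρ • w, ⟨c • w, ⟨w, hmem, rfl⟩, by rw [hyz]; module⟩, ?_⟩
  rintro x ⟨_, ⟨u, hu, rfl⟩, hx⟩
  have h1 := hA.1 x u _ w hu hmem
  have e : x - (z - ρ • w) = -(c • (u - w)) := by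
    rw [eq_sub_of_add_eq hx.symm, hyz]; module
  rw [e, inner_neg_right, real_inner_smul_right, real_inner_self_eq_norm_sq] at h1
  have h2 : ‖u - w‖ ^ 2 = 0 := by nlinarith [sq_nonneg ‖u - w‖]
  have h3 : u = w := by simpa [sub_eq_zero] using h2
  rw [h3] at e
  simpa [sub_eq_zero] using e

theorem resolventMap_mem {E : Type*} [NormedAddCommGroup E] {A : E → Set E} {x : E}
    (h : ∃ y, y ∈ resolvent A x) : resolventMap A x ∈ resolvent A x :=
  Classical.epsilon_spec h

theorem resolventMap_scale_spec {A : E → Set E} {c : ℝ} {x : E}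
    (h : ∃ y, y ∈ resolvent (scale c A) x) :
    ∃ u ∈ A (resolventMap (scale c A) x), x = resolventMap (scale c A) x + c • u := by
  obtain ⟨_, ⟨u, hu, rfl⟩, hx⟩ := resolventMap_mem h
  exact ⟨u, hu, hx⟩

end SetOp

/-! ### Values and query counts of programs -/

namespace OracleProg

variable {E α : Type*} [NormedAddCommGroup E] [InnerProductSpace ℝ E] (F : E → E) (G : E → Set E)

@[simp] theorem value_pure (a : α) : value F G (pure a) = a := rfl
@[simp] theorem countF_pure (a : α) : countF F G (pure a : OracleProg E α) = 0 := rfl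
@[simp] theorem countResolvent_pure (a : α) :
    countResolvent F G (pure a : OracleProg E α) = 0 := rfl
@[simp] theorem value_queryF (x : E) : value F G (queryF x) = F x := rfl
@[simp] theorem countF_queryF (x : E) : countF F G (queryF x) = 1 := rfl
@[simp] theorem countResolvent_queryF (x : E) : countResolvent F G (queryF x) = 0 := rfl
@[simp] theorem value_queryResolvent (c : ℝ) (y : E) :
    value F G (queryResolvent c y) = SetOp.resolventMap (SetOp.scale c G) y := rfl
@[simp] theorem countF_queryResolvent (c : ℝ) (y : E) : countF F G (queryResolvent c y) = 0 := rfl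
@[simp] theorem countResolvent_queryResolvent (c : ℝ) (y : E) :
    countResolvent F G (queryResolvent c y) = 1 := rfl

@[simp] theorem value_bind {α β : Type _} (p : OracleProg E α) (f : α → OracleProg E β) :
    value F G (p >>= f) = value F G (f (value F G p)) := by
  induction p with
  | ret a => rfl
  | evalF x k ih => exact ih _
  | resolventG c y k ih => exact ih _

@[simp] theorem countF_bind {α β : Type _} (p : OracleProg E α) (f : α → OracleProg E β) :
    countF F G (p >>= f) = countF F G p + countF F G (f (value F G p)) := by
  induction p with
  | ret a => exact (Nat.zero_add _).symm
  | evalF x k ih => exact (congrArg (· + 1) (ih _)).trans (Nat.add_right_comm _ _ _)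
  | resolventG c y k ih => exact ih _

@[simp] theorem countResolvent_bind {α β : Type _} (p : OracleProg E α)
    (f : α → OracleProg E β) :
    countResolvent F G (p >>= f) =
      countResolvent F G p + countResolvent F G (f (value F G p)) := by
  induction p with
  | ret a => exact (Nat.zero_add _).symm
  | evalF x k ih => exact ih _
  | resolventG c y k ih => exact (congrArg (· + 1) (ih _)).trans (Nat.add_right_comm _ _ _)

end OracleProg

namespace Halpern

open OracleProg

variable {E : Type*} [NormedAddCommGroup E] [InnerProductSpace ℝ E] (F : E → E) (G : E → Set E)

theorem countF_approxResolvent (η L : ℝ) (N : ℕ) (x : E) :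
    countF F G (approxResolvent η L N x) = 2 * N := by
  induction N with
  | zero => rfl
  | succ N ih =>
    unfold approxResolvent at ih ⊢
    simp only [fbf, fbfStep, countF_bind, ih, countF_queryF, countF_pure, countF_queryResolvent]
    ring

theorem countResolvent_approxResolvent (η L : ℝ) (N : ℕ) (x : E) :
    countResolvent F G (approxResolvent η L N x) = N := by
  induction N with
  | zero => rfl
  | succ N ih =>
    unfold approxResolvent at ih ⊢
    simp only [fbf, fbfStep, countResolvent_bind, ih, countResolvent_queryF,
      countResolvent_pure, countResolvent_queryResolvent]

theorem callsAt_eq (η L ρ : ℝ) (x₀ : E) (k : ℕ) :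
    callsAt F G η L ρ x₀ k = 2 * innerIterations η L k := by
  simp only [callsAt, oracleCalls, step, countF_bind, countResolvent_bind, countF_pure,
    countResolvent_pure, countF_approxResolvent, countResolvent_approxResolvent]
  omega

theorem iterate_succ (η L ρ : ℝ) (x₀ : E) (k : ℕ) :
    iterate F G η L ρ x₀ (k + 1) =
      (1 / ((k : ℝ) + 2)) • x₀ + (1 - 1 / ((k : ℝ) + 2)) •
        ((1 - (1 - ρ / η)) • iterate F G η L ρ x₀ k + (1 - ρ / η) •
          value F G (approxResolvent η L (innerIterations η L k) (iterate F G η L ρ x₀ k))) := by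
  simp only [iterate, step, value_bind, value_pure]

theorem value_approxResolvent_zero (η L : ℝ) (x : E) :
    value F G (approxResolvent η L 0 x) = x := rfl

theorem value_approxResolvent_succ (η L : ℝ) (N : ℕ) (x z h : E)
    (hz : z = value F G (approxResolvent η L N x))
    (hh : h = SetOp.resolventMap (SetOp.scale (1 / (2 * (1 + η * L)) * η) G)
      (z - (1 / (2 * (1 + η * L))) • (z + η • F z - x))) :
    value F G (approxResolvent η L (N + 1) x) =
      h + (1 / (2 * (1 + η * L))) • (z + η • F z - x)
        - (1 / (2 * (1 + η * L))) • (h + η • F h - x) := by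
  subst hh hz
  simp only [approxResolvent, fbf, fbfStep, value_bind, value_queryF, value_pure,
    value_queryResolvent]

/-! ### Linear convergence of the inner loop -/

/-- The contraction of one forward-backward-forward step with step size `1 / (2 ℓ)` towards a zero
`s` of `A + B`, where `a ∈ A h` and `-B s ∈ A s` for a monotone `A`, and `B` is `μ`-strongly
monotone and `ℓ`-Lipschitz. -/
theorem norm_fbf_sub_sq_le {B : E → E} {μ ℓ : ℝ} (hμ : 0 < μ) (hμℓ : μ ≤ ℓ)
    (hmono : ∀ x y, μ * ‖x - y‖ ^ 2 ≤ inner ℝ (B x - B y) (x - y))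
    (hlip : ∀ x y, ‖B x - B y‖ ≤ ℓ * ‖x - y‖) {z h s a : E}
    (ha : 0 ≤ inner ℝ (a + B s) (h - s))
    (hz : z = (1 / (2 * ℓ)) • B z + h + (1 / (2 * ℓ)) • a) :
    ‖h + (1 / (2 * ℓ)) • B z - (1 / (2 * ℓ)) • B h - s‖ ^ 2
      ≤ Real.exp (-(μ / ℓ) / 2) * ‖z - s‖ ^ 2 := by
  have hℓ : 0 < ℓ := hμ.trans_le hμℓ
  set τ := 1 / (2 * ℓ) with hτ
  have hτ0 : 0 < τ := by positivity
  set z' := h + τ • B z - τ • B h with hz'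
  set q := μ / ℓ with hq
  have hq0 : 0 < q := by positivity
  have hq1 : q ≤ 1 := (div_le_one hℓ).2 hμℓ
  have hdiff : z - z' = τ • (a + B h) := by
    rw [hz', sub_eq_iff_eq_add]; nth_rw 1 [hz]; module
  have hid : ‖z' - s‖ ^ 2 = ‖z - s‖ ^ 2 - ‖z - h‖ ^ 2 + ‖z' - h‖ ^ 2
      - 2 * inner ℝ (z - z') (h - s) := by
    have e1 : z' - s = (z' - h) + (h - s) := by abel
    have e2 : z - s = (z - h) + (h - s) := by abel
    have e3 : z - z' = (z - h) - (z' - h) := by abel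
    rw [e1, e2, norm_add_sq_real, norm_add_sq_real, e3,
      inner_sub_left (z - h)]; ring
  have h1 : ‖z' - h‖ ≤ 1 / 2 * ‖z - h‖ := by
    have e : z' - h = τ • (B z - B h) := by rw [hz']; module
    rw [e, norm_smul, Real.norm_of_nonneg hτ0.le]
    calc τ * ‖B z - B h‖ ≤ τ * (ℓ * ‖z - h‖) := by gcongr; exact hlip _ _
      _ = 1 / 2 * ‖z - h‖ := by rw [hτ]; field_simp
  have h1' : ‖z' - h‖ ^ 2 ≤ (1 / 2 * ‖z - h‖) ^ 2 := by gcongr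
  have h2 : q * ‖h - s‖ ^ 2 ≤ 2 * inner ℝ (z - z') (h - s) := by
    have e : a + B h = (a + B s) + (B h - B s) := by abel
    rw [hdiff, real_inner_smul_left, e, inner_add_left]
    have := hmono h s
    calc q * ‖h - s‖ ^ 2 = 2 * (τ * (μ * ‖h - s‖ ^ 2)) := by rw [hτ, hq]; field_simp
      _ ≤ _ := by gcongr; linarith
  have htri : ‖z - s‖ ≤ ‖z - h‖ + ‖h - s‖ := norm_sub_le_norm_sub_add_norm_sub _ _ _
  have htri2 : ‖z - s‖ ^ 2 ≤ (‖z - h‖ + ‖h - s‖) ^ 2 := by gcongr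
  -- The minimum of `3/4 a² + q b²` under `a + b ≥ ‖z - s‖` is `3 q / (4 q + 3) ‖z - s‖²`, attained
  -- at `3 a = 4 q b`; hence the square passed to `nlinarith`.
  have h3 : (4 * q + 3) * ‖z' - s‖ ^ 2 ≤ (q + 3) * ‖z - s‖ ^ 2 := by
    have : ‖z' - s‖ ^ 2 ≤ ‖z - s‖ ^ 2 - 3 / 4 * ‖z - h‖ ^ 2 - q * ‖h - s‖ ^ 2 := by
      linarith
    nlinarith [mul_le_mul_of_nonneg_left this (by positivity : (0 : ℝ) ≤ 4 * q + 3),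
      sq_nonneg (3 * ‖z - h‖ - 4 * q * ‖h - s‖),
      mul_le_mul_of_nonneg_left htri2 (by positivity : (0 : ℝ) ≤ 3 * q)]
  have hexp : Real.exp (q / 2) ≤ 1 + q / 2 + (q / 2) ^ 2 := by
    have := Real.abs_exp_sub_one_sub_id_le (x := q / 2) (by rw [abs_of_pos] <;> linarith)
    linarith [(abs_le.1 this).2]
  have h4 : (q + 3) * Real.exp (q / 2) ≤ 4 * q + 3 := by
    calc (q + 3) * Real.exp (q / 2) ≤ (q + 3) * (1 + q / 2 + (q / 2) ^ 2) := by gcongr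
      -- Holds for `0 < q ≤ 1`, with equality at `q = 1`.
      _ ≤ _ := by nlinarith [mul_pos hq0 hq0, mul_nonneg hq0.le (sub_nonneg.2 hq1)]
  have h5 : Real.exp (q / 2) * ‖z' - s‖ ^ 2 ≤ ‖z - s‖ ^ 2 := by
    refine le_of_mul_le_mul_left ?_ (by positivity : 0 < q + 3)
    calc (q + 3) * (Real.exp (q / 2) * ‖z' - s‖ ^ 2)
        = (q + 3) * Real.exp (q / 2) * ‖z' - s‖ ^ 2 := by ring
      _ ≤ (4 * q + 3) * ‖z' - s‖ ^ 2 := by gcongr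
      _ ≤ _ := h3
  rw [neg_div, Real.exp_neg, inv_mul_eq_div, le_div_iff₀ (Real.exp_pos _)]
  linarith

/-- The linear convergence of the inner loop. -/
theorem norm_value_approxResolvent_sub_sq_le {η L : ℝ} (hη : 0 < η) (hL : 0 ≤ L) (hηL : η * L < 1)
    (hF : ∀ x y, ‖F x - F y‖ ≤ L * ‖x - y‖) (hG : SetOp.IsMonotone G)
    (hJ : ∀ c : ℝ, 0 < c → ∀ y, ∃ z, z ∈ SetOp.resolvent (SetOp.scale c G) y) {x s : E}
    (hs : s ∈ SetOp.resolvent (SetOp.scale η (SetOp.add F G)) x) (N : ℕ) :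
    ‖value F G (approxResolvent η L N x) - s‖ ^ 2
      ≤ Real.exp (-((1 - η * L) / (1 + η * L)) / 2 * N) * ‖x - s‖ ^ 2 := by
  have hηL0 : 0 ≤ η * L := by positivity
  induction N with
  | zero => simp [value_approxResolvent_zero]
  | succ N ih =>
    set z := value F G (approxResolvent η L N x) with hz
    set τ := 1 / (2 * (1 + η * L)) with hτ
    have hτ0 : 0 < τ := by positivity
    set h := SetOp.resolventMap (SetOp.scale (τ * η) G) (z - τ • (z + η • F z - x)) with hh
    rw [value_approxResolvent_succ F G η L N x z h hz hh]
    obtain ⟨u, hu, hzu⟩ := SetOp.resolventMap_scale_spec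
      (hJ (τ * η) (by positivity) (z - τ • (z + η • F z - x)))
    rw [← hh] at hu hzu
    obtain ⟨_, ⟨_, ⟨v, hv, rfl⟩, rfl⟩, hxs⟩ := hs
    have hdiff : ∀ y w : E, y + η • F y - x - (w + η • F w - x) = (y - w) + η • (F y - F w) :=
      fun y w => by module
    have hstep := norm_fbf_sub_sq_le (B := fun y => y + η • F y - x) (μ := 1 - η * L)
      (ℓ := 1 + η * L) (z := z) (h := h) (s := s) (a := η • u) (by linarith) (by linarith)
      (fun y w => by
        have h1 := abs_le.1 (abs_real_inner_le_norm (F y - F w) (y - w))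
        have h2 := mul_le_mul_of_nonneg_right (hF y w) (norm_nonneg (y - w))
        have h3 : -(L * ‖y - w‖ * ‖y - w‖) ≤ inner ℝ (F y - F w) (y - w) := by linarith
        rw [hdiff, inner_add_left, real_inner_smul_left, real_inner_self_eq_norm_sq]
        nlinarith)
      (fun y w => by
        rw [hdiff]
        refine (norm_add_le _ _).trans ?_
        rw [norm_smul, Real.norm_of_nonneg hη.le]
        nlinarith [hF y w])
      (by
        have e : η • u + (s + η • F s - x) = η • (u - v) := by rw [hxs]; module
        rw [e, real_inner_smul_left]
        exact mul_nonneg hη.le (hG _ _ _ _ hu hv))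
      (by rw [← hτ, smul_smul, add_assoc, ← hzu]; abel)
    refine hstep.trans ((mul_le_mul_of_nonneg_left ih (Real.exp_pos _).le).trans_eq ?_)
    rw [← mul_assoc, ← Real.exp_add]
    congr 2
    push_cast
    ring

theorem one_lt_errorScale (k : ℕ) :
    1 < 98 * Real.sqrt ((k : ℝ) + 2) * Real.log ((k : ℝ) + 2) := by
  have hk : (0 : ℝ) ≤ k := k.cast_nonneg
  have h1 : 1 ≤ Real.sqrt ((k : ℝ) + 2) := Real.one_le_sqrt.2 (by linarith)
  have h2 : 1 / 2 ≤ Real.log ((k : ℝ) + 2) :=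
    (by linarith [Real.log_two_gt_d9] : (1 : ℝ) / 2 ≤ Real.log 2).trans
      (Real.log_le_log (by norm_num) (by linarith))
  nlinarith

/-- The accuracy reached by `N_k` inner iterations. -/
theorem errorScale_mul_norm_sub_le {η L : ℝ} (hη : 0 < η) (hL : 0 ≤ L) (hηL : η * L < 1)
    (hF : ∀ x y, ‖F x - F y‖ ≤ L * ‖x - y‖) (hG : SetOp.IsMonotone G)
    (hJ : ∀ c : ℝ, 0 < c → ∀ y, ∃ z, z ∈ SetOp.resolvent (SetOp.scale c G) y) {x s : E}
    (hs : s ∈ SetOp.resolvent (SetOp.scale η (SetOp.add F G)) x) (k : ℕ) :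
    98 * Real.sqrt ((k : ℝ) + 2) * Real.log ((k : ℝ) + 2) *
      ‖value F G (approxResolvent η L (innerIterations η L k) x) - s‖ ≤ ‖x - s‖ := by
  set M := 98 * Real.sqrt ((k : ℝ) + 2) * Real.log ((k : ℝ) + 2) with hM
  have hM0 : 0 < M := one_pos.trans (one_lt_errorScale k)
  have hηL0 : 0 ≤ η * L := by positivity
  have hp : 0 < 1 - η * L := by linarith
  have h1 := norm_value_approxResolvent_sub_sq_le F G hη hL hηL hF hG hJ hs
    (innerIterations η L k)
  have h2 : 4 * (1 + η * L) / (1 - η * L) * Real.log M ≤ innerIterations η L k := Nat.le_ceil _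
  -- The constant `4` in `N_k` makes the exponent at most `-2 log M`, so the squared error shrinks
  -- by `M²`.
  have h3 : -((1 - η * L) / (1 + η * L)) / 2 * (innerIterations η L k : ℝ)
      ≤ -(Real.log M + Real.log M) := by
    have := mul_le_mul_of_nonneg_left h2
      (by positivity : 0 ≤ (1 - η * L) / (1 + η * L) / 2)
    have e : (1 - η * L) / (1 + η * L) / 2 * (4 * (1 + η * L) / (1 - η * L) * Real.log M)
        = Real.log M + Real.log M := by field_simp; ring
    rw [e] at this
    linarith
  have h4 := h1.trans (mul_le_mul_of_nonneg_right (Real.exp_le_exp.2 h3) (sq_nonneg _))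
  rw [Real.exp_neg, Real.exp_add, Real.exp_log hM0, inv_mul_eq_div,
    le_div_iff₀ (by positivity)] at h4
  refine le_of_sq_le_sq ?_ (norm_nonneg _)
  linarith [h4]

end Halpern

/-! ### Potential argument for inexact Halpern -/

namespace Halpern

variable {E : Type*} [NormedAddCommGroup E] [InnerProductSpace ℝ E]

/-- The decrease of the Halpern potential over one inexact step, with residuals `r` and `r'` at
`x` and `x'`. -/
theorem potential_step {i : ℝ} (hi : 0 < i) {x₀ x x' r r' e : E}
    (hx' : (i + 1) • x' = x₀ + i • (x - r + e))
    (hfirm : ‖r' - r‖ ^ 2 ≤ inner ℝ (r' - r) (x' - x)) :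
    i * (i + 1) / 2 * ‖r'‖ ^ 2 + (i + 1) * inner ℝ r' (x' - x₀)
      ≤ i * (i - 1) / 2 * ‖r‖ ^ 2 + i * inner ℝ r (x - x₀)
        + i * (i + 1) / 2 * ‖e‖ ^ 2 + i * inner ℝ r e := by
  have e1 : (i + 1) * inner ℝ r' (x' - x₀) = i * inner ℝ r' ((x - x₀) - r + e) := by
    rw [← real_inner_smul_right, ← real_inner_smul_right, smul_sub, hx']
    congr 1
    module
  have e2 : (i * (i + 1)) * inner ℝ (r' - r) (x' - x)
      = inner ℝ (r' - r) (i ^ 2 • ((x - x₀) - r + e) - (i * (i + 1)) • (x - x₀)) := by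
    rw [← real_inner_smul_right, smul_sub, mul_smul, hx']
    congr 1
    module
  have h1 := mul_le_mul_of_nonneg_left hfirm (by positivity : 0 ≤ i * (i + 1))
  have h2 : 0 ≤ i * (i + 1) / 2 * ‖r' - r - e‖ ^ 2 := by positivity
  rw [e2] at h1
  rw [e1]
  generalize x - x₀ = w at *
  simp only [← real_inner_self_eq_norm_sq, inner_sub_left, inner_sub_right, inner_add_right,
    real_inner_smul_right, real_inner_comm r r', real_inner_comm e r', real_inner_comm e r]
    at h1 h2 ⊢
  -- The gap between the two sides equals the slack in `h1` plus the square in `h2`.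
  linarith

/-- The rate of the inexact Halpern iteration for a firmly nonexpansive map with residuals `r k`,
a fixed point `p`, and relative errors `ε k`. -/
theorem mul_norm_residual_le {x r e : ℕ → E} {p : E} {ε : ℕ → ℝ}
    (hstep : ∀ k : ℕ, x (k + 1) = (1 / ((k : ℝ) + 2)) • x 0
      + (1 - 1 / ((k : ℝ) + 2)) • (x k - r k + e k))
    (hfirm : ∀ j k, ‖r j - r k‖ ^ 2 ≤ inner ℝ (r j - r k) (x j - x k))
    (hzero : ∀ k, ‖r k‖ ^ 2 ≤ inner ℝ (r k) (x k - p))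
    (he : ∀ k, ‖e k‖ ≤ ε k * ‖r k‖) (hε : ∀ k, 0 ≤ ε k)
    (hsum : ∀ n, ∑ k ∈ Finset.range n, (ε k ^ 2 + ε k / ((k : ℝ) + 1)) ≤ 1 / 4) (k : ℕ) :
    ((k : ℝ) + 1) * ‖r k‖ ≤ 4 * ‖x 0 - p‖ := by
  set D := ‖x 0 - p‖ with hD
  let V : ℕ → ℝ := fun k =>
    -- Both terms vanish at `k = 0`, so the potential starts at zero.
    ((k : ℝ) + 1) * k / 2 * ‖r k‖ ^ 2 + ((k : ℝ) + 1) * inner ℝ (r k) (x k - x 0)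
  -- With `t = (k + 1) ‖r k‖`, cocoercivity against `p` gives `V k ≥ t² / 2 - t D`, which exceeds `4
  -- D²` once `t > 4 D`.
  have hbound : ∀ k, V k ≤ 4 * D ^ 2 → ((k : ℝ) + 1) * ‖r k‖ ≤ 4 * D := by
    intro k hk
    have h1 : -(‖r k‖ * D) + ‖r k‖ ^ 2 ≤ inner ℝ (r k) (x k - x 0) := by
      have e : x k - x 0 = (x k - p) - (x 0 - p) := by abel
      rw [e, inner_sub_right]
      linarith [hzero k, real_inner_le_norm (r k) (x 0 - p)]
    have h2 := mul_le_mul_of_nonneg_left h1 (by positivity : 0 ≤ (k : ℝ) + 1)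
    by_contra! hlt
    have hpos : 0 ≤ ((k : ℝ) + 1) * ‖r k‖ ^ 2 := by positivity
    simp only [V] at hk
    nlinarith [norm_nonneg (x 0 - p)]
  have hV : ∀ k, V (k + 1) ≤ V k + (((k : ℝ) + 1) * ‖r k‖) ^ 2
      * (ε k ^ 2 + ε k / ((k : ℝ) + 1)) := by
    intro k
    have hi : (0 : ℝ) < (k : ℝ) + 1 := by positivity
    have h1 := potential_step hi (x₀ := x 0) (x := x k) (x' := x (k + 1)) (r := r k)
      (r' := r (k + 1)) (e := e k) (by
        rw [hstep k, smul_add, smul_smul, smul_smul]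
        have hk : (k : ℝ) + 2 ≠ 0 := by positivity
        congr 1
        · rw [show ((k : ℝ) + 1 + 1) * (1 / ((k : ℝ) + 2)) = 1 by field_simp; ring, one_smul]
        · congr 1; field_simp; ring) (hfirm _ _)
    have h2 : ‖e k‖ ^ 2 ≤ ε k ^ 2 * ‖r k‖ ^ 2 := by
      rw [← mul_pow]; exact pow_le_pow_left₀ (norm_nonneg _) (he k) 2
    have h3 : inner ℝ (r k) (e k) ≤ ε k * ‖r k‖ ^ 2 := by
      nlinarith [real_inner_le_norm (r k) (e k), he k, norm_nonneg (r k)]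
    have h4 : ((k : ℝ) + 1) * ((k : ℝ) + 1 + 1) / 2 * ‖e k‖ ^ 2
        ≤ ((k : ℝ) + 1) ^ 2 * (ε k ^ 2 * ‖r k‖ ^ 2) := by
      refine mul_le_mul ?_ h2 (sq_nonneg _) (sq_nonneg _)
      nlinarith [k.cast_nonneg (α := ℝ)]
    have h5 := mul_le_mul_of_nonneg_left h3 hi.le
    have h6 : (((k : ℝ) + 1) * ‖r k‖) ^ 2 * (ε k ^ 2 + ε k / ((k : ℝ) + 1))
        = ((k : ℝ) + 1) ^ 2 * (ε k ^ 2 * ‖r k‖ ^ 2) + ((k : ℝ) + 1) * (ε k * ‖r k‖ ^ 2) := by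
      field_simp
    simp only [V]
    push_cast
    rw [h6]
    linarith
  -- Bootstrap: the bound on `V k` yields the rate at `k`, which controls the error added in passing
  -- to `V (k + 1)`.
  have hVk : ∀ k, V k ≤ 16 * D ^ 2 *
      ∑ j ∈ Finset.range k, (ε j ^ 2 + ε j / ((j : ℝ) + 1)) := by
    intro k
    induction k with
    | zero => simp [V]
    | succ k ih =>
      have hs : ((k : ℝ) + 1) * ‖r k‖ ≤ 4 * D :=
        hbound k (ih.trans (by nlinarith [hsum k, sq_nonneg D]))
      have hδ : 0 ≤ ε k ^ 2 + ε k / ((k : ℝ) + 1) := by have := hε k; positivity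
      have hs2 : (((k : ℝ) + 1) * ‖r k‖) ^ 2 ≤ (4 * D) ^ 2 :=
        pow_le_pow_left₀ (by positivity) hs 2
      rw [Finset.sum_range_succ]
      nlinarith [hV k, mul_le_mul_of_nonneg_right hs2 hδ]
  exact hbound k ((hVk k).trans (by nlinarith [hsum k, sq_nonneg D]))

/-! ### Summability of the errors -/

/-- Each later term is at most a difference of consecutive values of `1 / log`, so the sum
telescopes. At `n = 0` the subtracted term is `1 / 0 = 0`, so the induction starts at `n = 1`. -/
theorem sum_inv_mul_log_sq_le (n : ℕ) :
    ∑ k ∈ Finset.range n, 1 / (((k : ℝ) + 2) * Real.log ((k : ℝ) + 2) ^ 2)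
      ≤ 4 - 1 / Real.log ((n : ℝ) + 1) := by
  rcases n with _ | n
  · simp
  induction n with
  | zero =>
    have h1 := Real.log_two_gt_d9
    have h2 : 1 / Real.log 2 ≤ 1 / 0.69 := by gcongr; linarith
    have h3 : 1 / (2 * Real.log 2 ^ 2) ≤ 1 / (2 * 0.69 ^ 2) := by gcongr; linarith
    norm_num at h2 h3 ⊢
    linarith
  | succ n ih =>
    rw [Finset.sum_range_succ]
    push_cast at ih ⊢
    have ea : (n : ℝ) + 1 + 1 = n + 2 := by ring
    have eb : (n : ℝ) + 1 + 2 = n + 3 := by ring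
    rw [ea] at ih ⊢
    rw [eb, show (n : ℝ) + 2 + 1 = n + 3 by ring]
    set a := Real.log ((n : ℝ) + 2) with ha
    set b := Real.log ((n : ℝ) + 3) with hb
    have ha0 : 0 < a := Real.log_pos (by linarith [n.cast_nonneg (α := ℝ)])
    have hdiff : 1 / ((n : ℝ) + 3) ≤ b - a := by
      have := Real.one_sub_inv_le_log_of_pos (x := ((n : ℝ) + 3) / (n + 2)) (by positivity)
      rw [Real.log_div (by positivity) (by positivity), ← hb, ← ha] at this
      refine le_trans (le_of_eq ?_) this
      field_simp; ring
    have hab : a ≤ b := by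
      have : (0 : ℝ) ≤ 1 / ((n : ℝ) + 3) := by positivity
      linarith
    have hb0 : 0 < b := ha0.trans_le hab
    have h1 : 1 / (((n : ℝ) + 3) * b ^ 2) ≤ 1 / a - 1 / b := by
      have e1 : 1 / (((n : ℝ) + 3) * b ^ 2) = 1 / ((n : ℝ) + 3) * (1 / (b * b)) := by
        field_simp
      have e2 : 1 / a - 1 / b = (b - a) * (1 / (a * b)) := by field_simp
      rw [e1, e2]
      gcongr
    linarith

theorem sum_inv_mul_sqrt_le (n : ℕ) :
    ∑ k ∈ Finset.range n, 1 / (((k : ℝ) + 1) * Real.sqrt ((k : ℝ) + 2))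
      ≤ 3 - 3 / Real.sqrt ((n : ℝ) + 1) := by
  induction n with
  | zero => simp
  | succ n ih =>
    rw [Finset.sum_range_succ]
    push_cast at ih ⊢
    rw [show (n : ℝ) + 1 + 1 = n + 2 by ring]
    set a := Real.sqrt ((n : ℝ) + 1) with ha
    set b := Real.sqrt ((n : ℝ) + 2) with hb
    have ha2 : a ^ 2 = n + 1 := Real.sq_sqrt (by positivity)
    have hb2 : b ^ 2 = n + 2 := Real.sq_sqrt (by positivity)
    have ha0 : 0 < a := Real.sqrt_pos.2 (by positivity)
    have hb0 : 0 < b := Real.sqrt_pos.2 (by positivity)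
    -- With `b - a = 1 / (a + b)`, this gives `3 a (b - a) ≥ 1`, which is where the `3` comes from.
    have h2a : b ≤ 2 * a := by
      refine le_of_sq_le_sq ?_ (by positivity)
      nlinarith [n.cast_nonneg (α := ℝ)]
    have hdiff : (b - a) * (b + a) = 1 := by linarith [mul_self_nonneg a, ha2, hb2]
    have h1 : 1 / (((n : ℝ) + 1) * b) ≤ 3 / a - 3 / b := by
      have e : 3 / a - 3 / b = 3 * a * (b - a) / (a ^ 2 * b) := by field_simp
      rw [e, ← ha2]
      gcongr
      have : 0 ≤ b - a := by nlinarith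
      nlinarith
    linarith

/-- The squares sum to at most `4 / 98²`; the linear terms, using `log (k + 2) ≥ 1 / 2`, to at most
`3 / 49`. -/
theorem sum_errorScale_le (n : ℕ) :
    ∑ k ∈ Finset.range n,
      ((98 * Real.sqrt ((k : ℝ) + 2) * Real.log ((k : ℝ) + 2))⁻¹ ^ 2 +
        (98 * Real.sqrt ((k : ℝ) + 2) * Real.log ((k : ℝ) + 2))⁻¹ / ((k : ℝ) + 1)) ≤ 1 / 4 := by
  have hn : 0 ≤ Real.log ((n : ℝ) + 1) := Real.log_nonneg (by linarith [n.cast_nonneg (α := ℝ)])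
  have h1 := (sum_inv_mul_log_sq_le n).trans
    (by linarith [one_div_nonneg.2 hn] : 4 - 1 / Real.log ((n : ℝ) + 1) ≤ 4)
  have h2 := (sum_inv_mul_sqrt_le n).trans
    (by linarith [div_nonneg zero_le_three (Real.sqrt_nonneg ((n : ℝ) + 1))] :
      3 - 3 / Real.sqrt ((n : ℝ) + 1) ≤ 3)
  calc _ ≤ ∑ k ∈ Finset.range n,
        (1 / 98 ^ 2 * (1 / (((k : ℝ) + 2) * Real.log ((k : ℝ) + 2) ^ 2)) +
          1 / 49 * (1 / (((k : ℝ) + 1) * Real.sqrt ((k : ℝ) + 2)))) := by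
        refine Finset.sum_le_sum fun k _ => ?_
        have hl : 1 / 2 ≤ Real.log ((k : ℝ) + 2) :=
          (by linarith [Real.log_two_gt_d9] : (1 : ℝ) / 2 ≤ Real.log 2).trans
            (Real.log_le_log (by norm_num) (by linarith [k.cast_nonneg (α := ℝ)]))
        set l := Real.log ((k : ℝ) + 2)
        set b := Real.sqrt ((k : ℝ) + 2) with hb
        have hb0 : 0 < b := Real.sqrt_pos.2 (by positivity)
        have hb2 : b ^ 2 = k + 2 := Real.sq_sqrt (by positivity)
        have hl0 : 0 < l := by linarith
        refine add_le_add (le_of_eq ?_) ?_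
        · rw [← hb2]; field_simp
        · calc (98 * b * l)⁻¹ / ((k : ℝ) + 1) ≤ (98 * b * (1 / 2))⁻¹ / ((k : ℝ) + 1) := by gcongr
            _ = _ := by field_simp; norm_num
    _ ≤ 1 / 98 ^ 2 * 4 + 1 / 49 * 3 := by
        rw [Finset.sum_add_distrib, ← Finset.mul_sum, ← Finset.mul_sum]
        gcongr
    _ ≤ 1 / 4 := by norm_num

end Halpern

/-! ### Assembly -/

theorem theorem1 (d : ℕ) (F : Vec d → Vec d) (G : Vec d → Set (Vec d)) (L : ℝ≥0) (η ρ : ℝ)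
    (hL : 0 < L) (hF : LipschitzWith L F) (hG : SetOp.IsMaximallyMonotone G)
    (hρ : 0 ≤ ρ) (hFG : SetOp.IsMaximallyCohypomonotone ρ (SetOp.add F G))
    (hρη : ρ < η) (hηL : η < 1 / (L : ℝ))
    (xstar : Vec d) (hstar : (0 : Vec d) ∈ SetOp.add F G xstar) (x₀ : Vec d) :
    -- the resolvents used by the algorithm and in the bound are single-valued with full domain
    (∀ c : ℝ, 0 < c → ∀ y : Vec d, ∃! z, z ∈ SetOp.resolvent (SetOp.scale c G) y) ∧
    (∀ y : Vec d, ∃! z, z ∈ SetOp.resolvent (SetOp.scale η (SetOp.add F G)) y) ∧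
    -- the last-iterate rate
    (∀ k : ℕ, 1 ≤ k →
      1 / η ^ 2 * ‖Halpern.iterate F G η L ρ x₀ k -
          SetOp.resolventMap (SetOp.scale η (SetOp.add F G)) (Halpern.iterate F G η L ρ x₀ k)‖ ^ 2
        ≤ 16 * ‖x₀ - xstar‖ ^ 2 / ((η - ρ) ^ 2 * ((k : ℝ) + 1) ^ 2)) ∧
    -- the oracle complexity of each iteration
    (∀ k : ℕ, Halpern.callsAt F G η L ρ x₀ k ≤ 2 * Halpern.innerIterations η L k) := by
  have hη : 0 < η := hρ.trans_lt hρη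
  have hκ : 0 < η - ρ := sub_pos.2 hρη
  have hL0 : (0 : ℝ) < L := hL
  have hηL1 : η * L < 1 := (lt_div_iff₀ hL0).1 hηL
  have hJG : ∀ c : ℝ, 0 < c → ∀ y : Vec d, ∃! z, z ∈ SetOp.resolvent (SetOp.scale c G) y :=
    fun c hc => hG.isMaximallyCohypomonotone.existsUnique_mem_resolvent hc
  have hJ : ∀ y : Vec d, ∃! z, z ∈ SetOp.resolvent (SetOp.scale η (SetOp.add F G)) y :=
    hFG.existsUnique_mem_resolvent hρη
  refine ⟨hJG, hJ, fun k _ => ?_, fun k => (Halpern.callsAt_eq F G η L ρ x₀ k).le⟩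
  let x := Halpern.iterate F G η L ρ x₀
  let s : ℕ → Vec d := fun k => SetOp.resolventMap (SetOp.scale η (SetOp.add F G)) (x k)
  have hspec : ∀ k, ∃ u ∈ SetOp.add F G (s k), x k = s k + η • u :=
    fun k => SetOp.resolventMap_scale_spec (hJ (x k)).exists
  choose u hu hxu using hspec
  -- Cocoercivity of the residual: of the `η ‖u - v‖²` gained from `x = s + η u`, cohypomonotonicity
  -- costs at most `ρ ‖u - v‖²`. Taking `v = 0` at `xstar` gives the fixed-point inequality.
  have hcoh : ∀ j y v, v ∈ SetOp.add F G y →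
      ‖(η - ρ) • (u j - v)‖ ^ 2 ≤ inner ℝ ((η - ρ) • (u j - v)) (s j + η • u j - (y + η • v)) := by
    intro j y v hv
    have h1 : -ρ * ‖u j - v‖ ^ 2 ≤ inner ℝ (u j - v) (s j - y) := hFG.1 _ _ _ _ (hu j) hv
    have e : s j + η • u j - (y + η • v) = (s j - y) + η • (u j - v) := by module
    rw [e, norm_smul, mul_pow, Real.norm_eq_abs, sq_abs, real_inner_smul_left, inner_add_right,
      real_inner_smul_right, real_inner_self_eq_norm_sq]
    nlinarith [mul_le_mul_of_nonneg_left h1 hκ.le]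
  have hα : (1 - ρ / η) * η = η - ρ := by field_simp
  have hα0 : 0 ≤ 1 - ρ / η := sub_nonneg.2 ((div_le_one hη).2 hρη.le)
  let J : ℕ → Vec d := fun k => OracleProg.value F G
    (Halpern.approxResolvent η L (Halpern.innerIterations η L k) (x k))
  have hrate := Halpern.mul_norm_residual_le (x := x) (r := fun k => (η - ρ) • u k)
    (e := fun k => (1 - ρ / η) • (J k - s k)) (p := xstar)
    (ε := fun k => (98 * Real.sqrt ((k : ℝ) + 2) * Real.log ((k : ℝ) + 2))⁻¹)
    (fun k => by
      have e : x k - (η - ρ) • u k + (1 - ρ / η) • (J k - s k)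
          = (1 - (1 - ρ / η)) • x k + (1 - ρ / η) • J k := by
        have e' : s k = x k - η • u k := eq_sub_of_add_eq (hxu k).symm
        rw [e', ← hα]
        module
      simp only [e]
      exact Halpern.iterate_succ F G η L ρ x₀ k)
    (fun j k => by
      simpa only [smul_sub, ← hxu] using hcoh j (s k) (u k) (hu k))
    (fun k => by simpa only [sub_zero, smul_zero, add_zero, ← hxu] using hcoh k xstar 0 hstar)
    (fun k => by
      have hM := one_pos.trans (Halpern.one_lt_errorScale k)
      have h := Halpern.errorScale_mul_norm_sub_le F G hη hL0.le hηL1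
        (fun y w => by simpa [dist_eq_norm] using hF.dist_le_mul y w) hG.1
        (fun c hc y => (hJG c hc y).exists)
        (s := s k) (SetOp.resolventMap_mem (hJ (x k)).exists) k
      have e : x k - s k = η • u k := sub_eq_of_eq_add' (hxu k)
      rw [e, ← le_div_iff₀' hM, norm_smul, Real.norm_of_nonneg hη.le] at h
      rw [norm_smul, norm_smul, Real.norm_of_nonneg hα0, Real.norm_of_nonneg hκ.le, ← hα]
      calc _ ≤ (1 - ρ / η) * (η * ‖u k‖ / _) := mul_le_mul_of_nonneg_left h hα0
        _ = _ := by rw [div_eq_mul_inv]; ring)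
    (fun k => inv_nonneg.2 (one_pos.trans (Halpern.one_lt_errorScale k)).le)
    Halpern.sum_errorScale_le k
  change 1 / η ^ 2 * ‖x k - s k‖ ^ 2 ≤ _
  have e : x k - s k = η • u k := sub_eq_of_eq_add' (hxu k)
  have hsq := pow_le_pow_left₀ (by positivity) hrate 2
  rw [norm_smul, Real.norm_of_nonneg hκ.le] at hsq
  rw [e, norm_smul, Real.norm_of_nonneg hη.le, le_div_iff₀ (by positivity)]
  calc 1 / η ^ 2 * (η * ‖u k‖) ^ 2 * ((η - ρ) ^ 2 * ((k : ℝ) + 1) ^ 2)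
      = (((k : ℝ) + 1) * ((η - ρ) * ‖u k‖)) ^ 2 := by field_simp
    _ ≤ (4 * ‖x 0 - xstar‖) ^ 2 := hsq
    _ = 16 * ‖x₀ - xstar‖ ^ 2 := by rw [mul_pow]; norm_num [x, Halpern.iterate]
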